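/- Let $k$ be a field, $n\ge 0$, let $M$ be a matroid on the ground set $[n]=\{1,\dots,n\}$, and let $W\subseteq k^n$ be a $k$-linear realization of $M$, i.e. a linear subspace such that, for every $B\subseteq[n]$, the coordinate projection $W\to k^B$ is an isomorphism if and only if $B$ is a basis of $M$. Let $r$ be the rank of $M$ (so $r=\dim W$). Let $$W^\perp=(k^n/W)^*=\Big\{v\in k^n : \sum_{i} v_iw_i=0\ \text{ for all } w\in W\Big\},$$ let $f_i\in W^*$ and $g_i\in (W^\perp)^*$ be the restrictions of the $i$-th coordinate function of $k^n$ to $W$ and to $W^\perp$, respectively, let $k[W]=\operatorname{Sym}(W^*)$ and $k[W^\perp]=\operatorname{Sym}((W^\perp)^*)$ be the coordinate rings, and put $S=k[W]\otimes_k k[W^\perp]$, which is a polynomial ring in $n$ variables. Let $$\mathfrak a=(f_1g_1,\dots,f_ng_n)\subseteq S$$ be the ideal of pairs. A flat of $M$ is called cyclic if it is a union of circuits of $M$; let $\mathrm{cyc}(M)$ be the set of cyclic flats. Then $$\operatorname{pdim}_S(S/\mathfrak a)\ \ge\ \max\{\,2\operatorname{rank}_M(F)-|F|+n-r \;:\;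 F\in\mathrm{cyc}(M)\,\}.$$ In particular, this holds for the hyperplane arrangement $\{\ker f_i\}_{i\in[n]}$ in $W$ whenever $M$ has no loops, i.e. all $f_i\neq 0$. -/

import Mathlib

namespace IdealOfPairs

universe u

/-- `W` is a `k`-linear realization of the matroid `M` on the ground set `Fin n`: the coordinate
projection `W → k^B` is an isomorphism exactly when `B` is a basis of `M`. -/
def IsLinearRealization {k : Type u} [Field k] {n : ℕ}
    (W : Submodule k (Fin n → k)) (M : Matroid (Fin n)) : Prop :=
  M.E = Set.univ ∧
    ∀ B : Set (Fin n),
      M.IsBase B ↔ Function.Bijective (fun (w : W) (i : B) => (w : Fin n → k) i)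

/-- A cyclic flat of `M`: a flat which is a union of circuits. -/
def IsCyclicFlat {α : Type*} (M : Matroid α) (F : Set α) : Prop :=
  M.IsFlat F ∧ ∃ 𝒞 : Set (Set α), (∀ C ∈ 𝒞, M.IsCircuit C) ∧ F = ⋃₀ 𝒞

/-- The dual realization `W^⊥ = (k^n / W)^*`, regarded as a subspace of `k^n` through the standard
basis: the vectors `v` with `∑ i, v i * w i = 0` for all `w ∈ W`. -/
def perp {k : Type u} [Field k] {n : ℕ} (W : Submodule k (Fin n → k)) :
    Submodule k (Fin n → k) where
  carrier := {v | ∀ w ∈ W, ∑ i, v i * w i = 0}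
  zero_mem' := by simp
  add_mem' := by
    intro a b ha hb w hw
    simp [add_mul, Finset.sum_add_distrib, ha w hw, hb w hw]
  smul_mem' := by
    intro c a ha w hw
    simp [mul_assoc, ← Finset.mul_sum, ha w hw]

/-- The restriction to the subspace `U` of the `i`-th coordinate function of `k^n`. -/
def coordForm {k : Type u} [Field k] {n : ℕ} (U : Submodule k (Fin n → k)) (i : Fin n) :
    Module.Dual k U :=
  (LinearMap.proj i).comp U.subtype

/-- The coordinate ring `k[U]` of a linear space `U`, the symmetric algebra of the dual of `U`. -/
abbrev CoordRing {k : Type u} [Field k] {n : ℕ} (U : Submodule k (Fin n → k)) : Type u :=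
  SymmetricAlgebra k (Module.Dual k U)

/-- The ring `S = k[W] ⊗ k[W^⊥]`, a polynomial ring in `n` variables over `k`. -/
abbrev PairRing {k : Type u} [Field k] {n : ℕ} (W : Submodule k (Fin n → k)) : Type u :=
  TensorProduct k (CoordRing W) (CoordRing (perp W))

/-- The linear form `f i`, the `i`-th coordinate function on `W`, as an element of `S`. -/
noncomputable def f {k : Type u} [Field k] {n : ℕ} (W : Submodule k (Fin n → k)) (i : Fin n) :
    PairRing W :=
  TensorProduct.tmul k (SymmetricAlgebra.ι k _ (coordForm W i)) 1

/-- The linear form `g i`, the `i`-th coordinate function on `W^⊥`, as an element of `S`. -/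
noncomputable def g {k : Type u} [Field k] {n : ℕ} (W : Submodule k (Fin n → k)) (i : Fin n) :
    PairRing W :=
  TensorProduct.tmul k 1 (SymmetricAlgebra.ι k _ (coordForm (perp W) i))

/-- The ideal of pairs `(f 1 * g 1, …, f n * g n)` of `S`. -/
noncomputable def idealOfPairs {k : Type u} [Field k] {n : ℕ} (W : Submodule k (Fin n → k)) :
    Ideal (PairRing W) :=
  Ideal.span (Set.range fun i => f W i * g W i)

end IdealOfPairs

/-! Fix a cyclic flat F. Let J be generated by the linear forms f_i (i ∈ F) and g_i (i ∉ F); it is a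
prime containing every f_i g_i. Let s be the product of the complementary factors, g_i for i ∈ F and
f_i for i ∉ F. Multiplying a generator of J by s lands in the ideal of pairs, so the two ideals
agree once s is inverted. No factor of s lies in J: flatness of F gives a point of W killing f_j for
j ∈ F but not a given f_i, i ∉ F, and a circuit inside F gives the analogous point of W^⊥. Hence S/𝔞
becomes a nonzero complete intersection after inverting s, and its projective dimension is at least
the number of independent linear forms generating J (`finrank_add_finrank_le_projectiveDimension`).

Homologically, Ext^c(S/𝔞, S_s) ≠ 0 for that number c, by dimension shifting along the regular
sequence (`card_le_projectiveDimension`). Linear algebra evaluates c: the g_i with i ∉ F span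
dimension n - r - (|F| - rank F) (`finrank_span_coordForm_perp`), so c = 2 rank F - |F| + n - r. -/

open CategoryTheory Abelian Module

namespace IdealOfPairs

universe u

/-! ### Nonvanishing Ext bounds projective dimension from below -/

section ExtLowerBound

variable {R : Type u} [CommRing R]

/-- If `s` is invertible on `N` and `s * x` kills `X`, then `x` kills `Ext X N i`. -/
lemma smul_ext_eq_zero {X N : ModuleCat.{u} R} {s x : R}
    (hX : (s * x) • 𝟙 X = 0) (hs : ∃ φ : N ⟶ N, s • φ = 𝟙 N) {i : ℕ} (e : Ext X N i) :
    x • e = 0 := by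
  obtain ⟨φ, hφ⟩ := hs
  -- Invertibility of s on N makes e divisible by s, so x • e is s * x times a class; that scalar
  -- can be moved to X, where it is zero.
  have h1 : e = s • e.comp (Ext.mk₀ φ) (add_zero i) := by
    rw [← Ext.comp_smul, ← Ext.mk₀_smul, hφ, Ext.comp_mk₀_id]
  have h2 : ∀ e' : Ext X N i, (s * x) • e' = 0 := fun e' => by
    have : (s * x) • e' = (Ext.mk₀ ((s * x) • 𝟙 X)).comp e' (zero_add i) := by
      rw [Ext.mk₀_smul, Ext.smul_comp, Ext.mk₀_id_comp]
    rw [this, hX, Ext.mk₀_zero, Ext.zero_comp]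
  rw [h1, smul_smul, mul_comm, h2]

/-- Dimension shifting along `0 → N → N → N' → 0` when the first map is multiplication by an
element which kills `Ext X N`. -/
lemma ext_vanishing_step (X : ModuleCat.{u} R) {N N' : Type u} [AddCommGroup N] [AddCommGroup N']
    [Module R N] [Module R N'] (x : R) (p : N →ₗ[R] N')
    (hinj : Function.Injective (LinearMap.lsmul R N x))
    (hex : Function.Exact (LinearMap.lsmul R N x) p) (hsurj : Function.Surjective p)
    (hx : ∀ i (e : Ext X (ModuleCat.of R N) i), x • e = 0) {m : ℕ}
    (hvan : ∀ j < m, Subsingleton (Ext X (ModuleCat.of R N') j))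
    (hnon : Nontrivial (Ext X (ModuleCat.of R N') m)) :
    (∀ j < m + 1, Subsingleton (Ext X (ModuleCat.of R N) j)) ∧
      Nontrivial (Ext X (ModuleCat.of R N) (m + 1)) := by
  let S : ShortComplex (ModuleCat.{u} R) :=
    ModuleCat.shortComplexOfCompEqZero (LinearMap.lsmul R N x) p hex.linearMap_comp_eq_zero
  have hf : S.f = x • 𝟙 (ModuleCat.of R N) := rfl
  have hS : S.ShortExact :=
    { exact := ModuleCat.shortComplex_exact _ hex
      mono_f := by simpa [S, ModuleCat.mono_iff_injective] using! hinj
      epi_g := by simpa [S, ModuleCat.epi_iff_surjective] using! hsurj }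
  have hz : ∀ i (e : Ext X S.X₁ i), e.comp (Ext.mk₀ S.f) (add_zero i) = 0 := fun i e => by
    rw [hf, Ext.mk₀_smul, Ext.comp_smul, Ext.comp_mk₀_id]
    exact hx i e
  have hsub : ∀ j < m + 1, Subsingleton (Ext X (ModuleCat.of R N) j) := by
    intro j hj
    refine subsingleton_of_forall_eq 0 fun e => ?_
    cases j with
    | zero =>
      -- Degree 0 has no connecting map into it; left exactness of Hom is used instead.
      have := hS.mono_f
      exact Ext.postcomp_mk₀_injective_of_mono X S.f ((hz 0 e).trans (map_zero _).symm)
    | succ j =>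
      obtain ⟨e₃, rfl⟩ := Ext.covariant_sequence_exact₁ X hS e (hz _ e) rfl
      have := hvan j (by omega)
      rw [Subsingleton.elim (α := Ext X (ModuleCat.of R N') j) e₃ 0, Ext.zero_comp]
  refine ⟨hsub, ?_⟩
  obtain ⟨e₃, he₃⟩ := exists_ne (0 : Ext X (ModuleCat.of R N') m)
  -- The connecting map is injective in degree m because Ext^m(X, N) vanishes.
  refine nontrivial_of_ne (e₃.comp hS.extClass rfl : Ext X S.X₁ (m + 1)) 0 fun h => he₃ ?_
  obtain ⟨e₂, rfl⟩ := Ext.covariant_sequence_exact₃ X hS e₃ rfl h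
  have := hsub m (by omega)
  rw [Subsingleton.elim (α := Ext X (ModuleCat.of R N) m) e₂ 0, Ext.zero_comp]

/-- A lower bound for the projective dimension of `R ⧸ I`: if after inverting `s` the ideal `I`
becomes the proper ideal generated by the `y c`, `c ∈ T`, and these elements form a regular
sequence in every order, then the projective dimension is at least the cardinality of `T`. -/
theorem card_le_projectiveDimension {ι : Type*} (I : Ideal R) (s : R) (y : ι → R) (T : Finset ι)
    (hreg : ∀ T' : Finset ι, ∀ c ∉ T', ∀ r,
      y c * r ∈ Ideal.span (y '' T') → r ∈ Ideal.span (y '' T'))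
    (hs : ∀ c ∈ T, s * y c ∈ I) (hI : I ≤ Ideal.span (y '' T))
    (hsT : ∀ n : ℕ, s ^ n ∉ Ideal.span (y '' T)) :
    (T.card : WithBot ℕ∞) ≤ projectiveDimension (ModuleCat.of R (R ⧸ I)) := by
  classical
  -- Only the target modules are localized, so all Ext groups stay over R and no change of rings is
  -- needed.
  let N : Finset ι → Type u := fun T' =>
    LocalizedModule (Submonoid.powers s) (R ⧸ Ideal.span (y '' (T' : Set ι)))
  let X := ModuleCat.of R (R ⧸ I)
  -- Induction on the number of elements still to be divided out: it starts from T' = T, where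
  -- Hom(R/I, N T) ≠ 0, and descends to T' = ∅.
  have key : ∀ m, ∀ T' ⊆ T, (T \ T').card = m →
      (∀ j < m, Subsingleton (Ext X (ModuleCat.of R (N T')) j)) ∧
        Nontrivial (Ext X (ModuleCat.of R (N T')) m) := by
    intro m
    induction m with
    | zero =>
      intro T' hT' hcard
      obtain rfl : T' = T := by
        rw [Finset.card_eq_zero, Finset.sdiff_eq_empty_iff_subset] at hcard
        exact hT'.antisymm hcard
      refine ⟨fun j hj => absurd hj (by omega), ?_⟩
      let φ : (R ⧸ I) →ₗ[R] N T' :=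
        (LocalizedModule.mkLinearMap (Submonoid.powers s) _).comp
          (Submodule.mapQ I (Ideal.span (y '' (T' : Set ι))) LinearMap.id hI)
      have hφ : φ ≠ 0 := by
        intro h0
        have h1 : φ (Submodule.Quotient.mk 1) = 0 := by rw [h0]; rfl
        obtain ⟨⟨_, n, rfl⟩, hn⟩ :=
          (IsLocalizedModule.eq_zero_iff (Submonoid.powers s)
            (LocalizedModule.mkLinearMap (Submonoid.powers s)
              (R ⧸ Ideal.span (y '' (T' : Set ι))))).1 h1
        apply hsT n
        have h2 : (Submodule.Quotient.mk (s ^ n * 1) :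
            R ⧸ Ideal.span (y '' (T' : Set ι))) = 0 := hn
        rwa [mul_one, Submodule.Quotient.mk_eq_zero] at h2
      refine nontrivial_of_ne (Ext.mk₀ (ModuleCat.ofHom φ)) 0 fun h => hφ ?_
      rw [← Ext.mk₀_zero] at h
      have h3 := (Ext.mk₀_bijective _ _).1 h
      exact congrArg ModuleCat.Hom.hom h3
    | succ m ih =>
      intro T' hT' hcard
      obtain ⟨c, hc⟩ : (T \ T').Nonempty := by
        rw [← Finset.card_pos]; omega
      obtain ⟨hcT, hcT'⟩ := Finset.mem_sdiff.1 hc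
      obtain ⟨hvan, hnon⟩ := ih (insert c T') (Finset.insert_subset hcT hT') (by
        rw [Finset.sdiff_insert, Finset.card_erase_of_mem hc, hcard]; rfl)
      have hle : Ideal.span (y '' (T' : Set ι)) ≤ Ideal.span (y '' (insert c T' : Finset ι)) :=
        Ideal.span_mono (Set.image_mono (by simp))
      let p₀ : (R ⧸ Ideal.span (y '' (T' : Set ι))) →ₗ[R]
          R ⧸ Ideal.span (y '' ((insert c T' : Finset ι) : Set ι)) :=
        Submodule.mapQ _ _ LinearMap.id hle
      have hinj₀ : Function.Injective
          (LinearMap.lsmul R (R ⧸ Ideal.span (y '' (T' : Set ι))) (y c)) := by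
        rw [injective_iff_map_eq_zero]
        intro a ha
        obtain ⟨r, rfl⟩ := Submodule.Quotient.mk_surjective _ a
        rw [Submodule.Quotient.mk_eq_zero]
        apply hreg T' c hcT' r
        rwa [← Submodule.Quotient.mk_eq_zero]
      have hsurj₀ : Function.Surjective p₀ := by
        intro a
        obtain ⟨r, rfl⟩ := Submodule.Quotient.mk_surjective _ a
        exact ⟨Submodule.Quotient.mk r, rfl⟩
      have hex₀ : Function.Exact
          (LinearMap.lsmul R (R ⧸ Ideal.span (y '' (T' : Set ι))) (y c)) p₀ := by
        intro a
        obtain ⟨r, rfl⟩ := Submodule.Quotient.mk_surjective _ a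
        have : p₀ (Submodule.Quotient.mk r) = Submodule.Quotient.mk r := rfl
        rw [this, Submodule.Quotient.mk_eq_zero, Finset.coe_insert, Set.image_insert_eq,
          Ideal.mem_span_insert]
        constructor
        · rintro ⟨a, z, hz, rfl⟩
          refine ⟨Submodule.Quotient.mk a, ?_⟩
          change Submodule.Quotient.mk (y c * a) = _
          rw [Submodule.Quotient.eq]
          have : y c * a - (a * y c + z) = -z := by ring
          rw [this]
          exact neg_mem hz
        · rintro ⟨b, hb⟩
          obtain ⟨b, rfl⟩ := Submodule.Quotient.mk_surjective _ b
          change Submodule.Quotient.mk (y c * b) = _ at hb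
          rw [Submodule.Quotient.eq] at hb
          exact ⟨b, r - y c * b, by simpa using neg_mem hb, by ring⟩
      let L := LocalizedModule.mkLinearMap (Submonoid.powers s)
        (R ⧸ Ideal.span (y '' (T' : Set ι)))
      let L' := LocalizedModule.mkLinearMap (Submonoid.powers s)
        (R ⧸ Ideal.span (y '' ((insert c T' : Finset ι) : Set ι)))
      have hmul : IsLocalizedModule.map (Submonoid.powers s) L L
          (LinearMap.lsmul R _ (y c)) = LinearMap.lsmul R (N T') (y c) := by
        apply IsLocalizedModule.linearMap_ext (Submonoid.powers s) L L
        refine LinearMap.ext fun a => ?_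
        change IsLocalizedModule.map _ L L _ (L a) = y c • L a
        rw [IsLocalizedModule.map_apply]
        exact map_smul L _ _
      refine ext_vanishing_step X (N := N T') (N' := N (insert c T')) (y c)
        (IsLocalizedModule.map (Submonoid.powers s) L L' p₀) ?_ ?_ ?_ ?_ hvan hnon
      · rw [← hmul]
        exact IsLocalizedModule.map_injective _ L L _ hinj₀
      · rw [← hmul]
        exact IsLocalizedModule.map_exact _ L L L' _ _ hex₀
      · exact IsLocalizedModule.map_surjective _ L L' _ hsurj₀
      · intro i e
        refine smul_ext_eq_zero (s := s) ?_ ?_ e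
        · refine ModuleCat.hom_ext (LinearMap.ext fun a => ?_)
          obtain ⟨r, rfl⟩ := Submodule.Quotient.mk_surjective _ a
          change (Submodule.Quotient.mk ((s * y c) * r) : R ⧸ I) = 0
          rw [Submodule.Quotient.mk_eq_zero]
          exact I.mul_mem_right _ (hs c hcT)
        · obtain ⟨u, hu⟩ := IsLocalizedModule.map_units L ⟨s, Submonoid.mem_powers s⟩
          refine ⟨ModuleCat.ofHom (↑u⁻¹ : Module.End R (N T')), ?_⟩
          refine ModuleCat.hom_ext (LinearMap.ext fun a => ?_)
          have h := congrArg (fun φ : Module.End R (N T') => φ a) u.mul_inv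
          rw [hu] at h
          exact h
  rw [projectiveDimension_ge_iff]
  intro h
  obtain ⟨-, hnon⟩ := key T.card ∅ (Finset.empty_subset _) (by simp)
  have := HasProjectiveDimensionLT.subsingleton X T.card T.card le_rfl (ModuleCat.of R (N ∅))
  exact not_subsingleton _ this

end ExtLowerBound

/-! ### Ideals generated by variables -/

section Polynomial

/-- The variables of a polynomial ring form a regular sequence in every order. -/
lemma mem_span_X_image_of_X_mul_mem {σ k : Type*} [CommRing k] {s : Set σ} {c : σ} (hc : c ∉ s)
    {p : MvPolynomial σ k} (h : MvPolynomial.X c * p ∈ Ideal.span (MvPolynomial.X '' s)) :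
    p ∈ Ideal.span (MvPolynomial.X '' s : Set (MvPolynomial σ k)) := by
  classical
  rw [MvPolynomial.mem_ideal_span_X_image] at h ⊢
  intro m hm
  obtain ⟨i, hi, hne⟩ := h (Finsupp.single c 1 + m) (by
    rw [MvPolynomial.mem_support_iff] at hm ⊢
    rwa [MvPolynomial.coeff_X_mul])
  refine ⟨i, hi, ?_⟩
  have hci : c ≠ i := fun h => hc (h ▸ hi)
  simpa [Finsupp.single_apply, hci] using hne

/-- An ideal generated by variables of a polynomial ring over a domain is prime. -/
lemma isPrime_span_X_image {σ k : Type*} [CommRing k] [IsDomain k] (s : Set σ) :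
    (Ideal.span (MvPolynomial.X '' s : Set (MvPolynomial σ k))).IsPrime := by
  classical
  let φ : MvPolynomial σ k →ₐ[k] MvPolynomial σ k :=
    MvPolynomial.aeval fun i => if i ∈ s then 0 else MvPolynomial.X i
  have hker : RingHom.ker φ = Ideal.span (MvPolynomial.X '' s) := by
    refine le_antisymm (fun p hp => ?_) (Ideal.span_le.2 ?_)
    · let q := Ideal.Quotient.mkₐ k (Ideal.span (MvPolynomial.X '' s : Set (MvPolynomial σ k)))
      -- Setting the variables in s to zero changes nothing modulo the ideal, so whatever φ kills
      -- lies in it.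
      have hq : q.comp φ = q := by
        refine MvPolynomial.algHom_ext fun i => ?_
        by_cases hi : i ∈ s
        · have h0 : q (MvPolynomial.X i) = 0 :=
            Ideal.Quotient.eq_zero_iff_mem.2 (Ideal.subset_span ⟨i, hi, rfl⟩)
          simp [φ, hi, h0]
        · simp [φ, hi]
      refine Ideal.Quotient.eq_zero_iff_mem.1 ?_
      change q p = 0
      rw [← hq, AlgHom.comp_apply, (RingHom.mem_ker).1 hp, map_zero]
    · rintro _ ⟨i, hi, rfl⟩
      change φ _ = 0
      simp [φ, hi]
  rw [← hker]
  exact RingHom.ker_isPrime φ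

lemma mem_span_image_iff_of_ringEquiv {ι A B : Type*} [CommRing A] [CommRing B] (e : A ≃+* B)
    (y : ι → A) (s : Set ι) (a : A) :
    a ∈ Ideal.span (y '' s) ↔ e a ∈ Ideal.span ((fun i => e (y i)) '' s) := by
  have : (fun i => e (y i)) '' s = e '' (y '' s) := by rw [Set.image_image]
  rw [this, ← Ideal.map_span, Ideal.mem_map_iff_of_surjective e e.surjective]
  exact ⟨fun h => ⟨a, h, rfl⟩, fun ⟨b, hb, hab⟩ => e.injective hab ▸ hb⟩

end Polynomial

/-! ### Coordinates and points on W × W^⊥ -/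

section PairRing

variable {k : Type u} [Field k] {n : ℕ} {W : Submodule k (Fin n → k)}

/-- The linear form on `W × W^⊥` attached to a linear form on `W`, as an element of `S`. -/
noncomputable def formLeft (W : Submodule k (Fin n → k)) : Dual k W →ₗ[k] PairRing W :=
  (Algebra.TensorProduct.includeLeft (R := k) (S := k) (A := CoordRing W)
    (B := CoordRing (perp W))).toLinearMap.comp (SymmetricAlgebra.ι k _)

/-- The linear form on `W × W^⊥` attached to a linear form on `W^⊥`, as an element of `S`. -/
noncomputable def formRight (W : Submodule k (Fin n → k)) : Dual k (perp W) →ₗ[k] PairRing W :=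
  (Algebra.TensorProduct.includeRight (R := k) (A := CoordRing W)
    (B := CoordRing (perp W))).toLinearMap.comp (SymmetricAlgebra.ι k _)

lemma formLeft_coordForm (i : Fin n) : formLeft W (coordForm W i) = f W i := rfl

lemma formRight_coordForm (i : Fin n) : formRight W (coordForm (perp W) i) = g W i := rfl

/-- Evaluation of the elements of `S` at a point of `W × W^⊥`. -/
noncomputable def evalPoint (w : W) (v : perp W) : PairRing W →ₐ[k] k :=
  Algebra.TensorProduct.productMap (SymmetricAlgebra.lift (Dual.eval k W w))
    (SymmetricAlgebra.lift (Dual.eval k (perp W) v))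

@[simp] lemma evalPoint_formLeft (w : W) (v : perp W) (φ : Dual k W) :
    evalPoint w v (formLeft W φ) = φ w := by
  simp [evalPoint, formLeft]

@[simp] lemma evalPoint_formRight (w : W) (v : perp W) (φ : Dual k (perp W)) :
    evalPoint w v (formRight W φ) = φ v := by
  simp [evalPoint, formRight]

/-- The polynomial variables of `S` given by bases of `W^*` and `(W^⊥)^*`. -/
noncomputable def formVar {ι₁ ι₂ : Type*} (b₁ : Basis ι₁ k (Dual k W))
    (b₂ : Basis ι₂ k (Dual k (perp W))) : ι₁ ⊕ ι₂ → PairRing W :=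
  Sum.elim (fun i => formLeft W (b₁ i)) (fun i => formRight W (b₂ i))

/-- The isomorphism of `S` with a polynomial ring given by bases of `W^*` and `(W^⊥)^*`. -/
noncomputable def pairRingEquiv {ι₁ ι₂ : Type*} (b₁ : Basis ι₁ k (Dual k W))
    (b₂ : Basis ι₂ k (Dual k (perp W))) : PairRing W ≃ₐ[k] MvPolynomial (ι₁ ⊕ ι₂) k :=
  (Algebra.TensorProduct.congr (SymmetricAlgebra.equivMvPolynomial b₁)
    (SymmetricAlgebra.equivMvPolynomial b₂)).trans
    (MvPolynomial.tensorEquivSum k ι₁ ι₂ k)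

lemma pairRingEquiv_formVar {ι₁ ι₂ : Type*} (b₁ : Basis ι₁ k (Dual k W))
    (b₂ : Basis ι₂ k (Dual k (perp W))) (i : ι₁ ⊕ ι₂) :
    pairRingEquiv b₁ b₂ (formVar b₁ b₂ i) = MvPolynomial.X i := by
  rcases i with i | i <;> simp [pairRingEquiv, formVar, formLeft, formRight]

lemma mem_span_formVar_iff {ι₁ ι₂ : Type*} (b₁ : Basis ι₁ k (Dual k W))
    (b₂ : Basis ι₂ k (Dual k (perp W))) (s : Set (ι₁ ⊕ ι₂)) (a : PairRing W) :
    a ∈ Ideal.span (formVar b₁ b₂ '' s) ↔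
      pairRingEquiv b₁ b₂ a ∈ Ideal.span (MvPolynomial.X '' s) := by
  rw [mem_span_image_iff_of_ringEquiv (pairRingEquiv b₁ b₂).toRingEquiv]
  have : (fun i => (pairRingEquiv b₁ b₂).toRingEquiv (formVar b₁ b₂ i)) = MvPolynomial.X :=
    funext (pairRingEquiv_formVar b₁ b₂)
  rw [this]
  rfl

lemma mem_span_formVar_of_mul_mem {ι₁ ι₂ : Type*} (b₁ : Basis ι₁ k (Dual k W))
    (b₂ : Basis ι₂ k (Dual k (perp W))) {s : Set (ι₁ ⊕ ι₂)} {c : ι₁ ⊕ ι₂} (hc : c ∉ s)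
    {a : PairRing W} (h : formVar b₁ b₂ c * a ∈ Ideal.span (formVar b₁ b₂ '' s)) :
    a ∈ Ideal.span (formVar b₁ b₂ '' s) := by
  rw [mem_span_formVar_iff] at h ⊢
  rw [map_mul, pairRingEquiv_formVar] at h
  exact mem_span_X_image_of_X_mul_mem hc h

lemma isPrime_span_formVar {ι₁ ι₂ : Type*} (b₁ : Basis ι₁ k (Dual k W))
    (b₂ : Basis ι₂ k (Dual k (perp W))) (s : Set (ι₁ ⊕ ι₂)) :
    (Ideal.span (formVar b₁ b₂ '' s)).IsPrime := by
  have h : Ideal.span (formVar b₁ b₂ '' s) =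
      (Ideal.span (MvPolynomial.X '' s)).comap (pairRingEquiv b₁ b₂) :=
    Ideal.ext fun a => mem_span_formVar_iff b₁ b₂ s a
  have := isPrime_span_X_image (k := k) s
  rw [h]
  exact Ideal.comap_isPrime _ _

end PairRing

/-- A basis of a vector space adapted to a subspace. -/
lemma exists_adapted_basis {k V : Type*} [Field k] [AddCommGroup V] [Module k V]
    [FiniteDimensional k V] (U : Submodule k V) :
    ∃ (m : ℕ) (b : Basis (Fin (finrank k U) ⊕ Fin m) k V),
      Submodule.span k (Set.range fun i => b (Sum.inl i)) = U := by
  obtain ⟨U', hU'⟩ := U.exists_isCompl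
  refine ⟨finrank k U', ((finBasis k U).prod (finBasis k U')).map
    (Submodule.prodEquivOfIsCompl U U' hU'), ?_⟩
  have h : (fun i : Fin (finrank k U) => (((finBasis k U).prod (finBasis k U')).map
      (Submodule.prodEquivOfIsCompl U U' hU')) (Sum.inl i)) = U.subtype ∘ finBasis k U := by
    funext i
    simp
  rw [h, Set.range_comp, ← Submodule.map_span, Basis.span_eq, Submodule.map_top,
    Submodule.range_subtype]

/-! ### Matroid data as linear algebra of coordinate forms -/

section Realization

variable {k : Type u} [Field k] {n : ℕ} {W : Submodule k (Fin n → k)} {M : Matroid (Fin n)}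

@[simp] lemma coordForm_apply (U : Submodule k (Fin n → k)) (i : Fin n) (u : U) :
    coordForm U i u = (u : Fin n → k) i := rfl

/-- The coordinate functions span the dual space. -/
lemma span_range_coordForm (U : Submodule k (Fin n → k)) :
    Submodule.span k (Set.range (coordForm U)) = ⊤ := by
  by_contra h
  obtain ⟨φ, hφ, h0⟩ := Submodule.exists_le_ker_of_lt_top _ (lt_top_iff_ne_top.2 h)
  obtain ⟨u, rfl⟩ := (evalEquiv k U).surjective φ
  apply hφ
  have : u = 0 := by
    ext i
    exact h0 (Submodule.subset_span ⟨i, rfl⟩)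
  rw [this, map_zero]

/-- A base B admits vectors of W dual to the forms indexed by B, so these are independent.
Conversely, independent forms extend to a spanning independent family, for which the projection is
injective between spaces of equal dimension. -/
lemma IsLinearRealization.indep_iff (hW : IsLinearRealization W M) (I : Set (Fin n)) :
    M.Indep I ↔ LinearIndepOn k (coordForm W) I := by
  classical
  constructor
  · intro hI
    obtain ⟨B, hB, hIB⟩ := hI.exists_isBase_superset
    refine LinearIndepOn.mono ?_ hIB
    have hbij := (hW.2 B).1 hB
    rw [LinearIndepOn, Fintype.linearIndependent_iff]
    intro c hc i
    obtain ⟨w, hw⟩ := hbij.2 (Pi.single i 1)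
    have h := congrArg (fun φ : Dual k W => φ w) hc
    have hw' : ∀ j : B, (w : Fin n → k) j = (Pi.single i 1 : B → k) j := fun j => congrFun hw j
    simpa [hw', Pi.single_apply] using h
  · intro hI
    obtain ⟨B, -, hIB, hspan, hB⟩ := exists_linearIndepOn_extension hI (Set.subset_univ I)
    rw [Set.image_univ] at hspan
    have hspan' : Submodule.span k (coordForm W '' B) = ⊤ := by
      rw [eq_top_iff, ← span_range_coordForm W]
      exact Submodule.span_le.2 hspan
    refine Matroid.IsBase.indep ?_ |>.subset hIB
    rw [hW.2 B]
    let π : W →ₗ[k] (B → k) := LinearMap.pi fun i : B => coordForm W i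
    have hinj : Function.Injective π := by
      rw [injective_iff_map_eq_zero]
      intro w hw
      have hle : Submodule.span k (coordForm W '' B) ≤ LinearMap.ker (Dual.eval k W w) := by
        rw [Submodule.span_le]
        rintro _ ⟨i, hi, rfl⟩
        exact congrFun hw ⟨i, hi⟩
      rw [hspan'] at hle
      ext i
      exact hle (Submodule.mem_top (x := coordForm W i))
    have hcard : finrank k (B → k) = finrank k W := by
      have h1 := finrank_span_eq_card hB.linearIndependent
      have h2 : Set.range (fun i : B => coordForm W i) = coordForm W '' B := by
        rw [Set.image_eq_range]
      rw [h2, hspan', finrank_top, Subspace.dual_finrank_eq] at h1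
      rw [finrank_fintype_fun_eq_card, h1]
    exact ⟨hinj, (LinearMap.injective_iff_surjective_of_finrank_eq_finrank hcard.symm).1 hinj⟩

lemma IsLinearRealization.subset_ground (hW : IsLinearRealization W M) (F : Set (Fin n)) :
    F ⊆ M.E := hW.1 ▸ Set.subset_univ F

/-- A form of F outside the span could be adjoined to I, against maximality of I in F. -/
lemma IsLinearRealization.span_isBasis (hW : IsLinearRealization W M) {I F : Set (Fin n)}
    (hI : M.IsBasis I F) :
    Submodule.span k (coordForm W '' I) = Submodule.span k (coordForm W '' F) := by
  refine le_antisymm (Submodule.span_mono (Set.image_mono hI.subset)) ?_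
  rw [Submodule.span_le]
  rintro _ ⟨j, hj, rfl⟩
  by_contra hn
  have hjI : j ∉ I := fun h => hn (Submodule.subset_span ⟨j, h, rfl⟩)
  apply hjI
  refine hI.mem_of_insert_indep hj ?_
  rw [hW.indep_iff, linearIndepOn_insert hjI, ← hW.indep_iff]
  exact ⟨hI.indep, hn⟩

lemma IsLinearRealization.eRk_toNat (hW : IsLinearRealization W M) (F : Set (Fin n)) :
    (M.eRk F).toNat = finrank k (Submodule.span k (coordForm W '' F)) := by
  classical
  obtain ⟨I, hI⟩ := M.exists_isBasis F (hW.subset_ground F)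
  rw [← hW.span_isBasis hI, hI.eRk_eq_encard, Set.image_eq_range]
  have h := finrank_span_eq_card ((hW.indep_iff I).1 hI.indep).linearIndependent
  rw [h, Fintype.card_eq_nat_card]
  rfl

lemma IsLinearRealization.eRank_toNat (hW : IsLinearRealization W M) :
    M.eRank.toNat = finrank k W := by
  rw [← M.eRk_ground, hW.eRk_toNat, hW.1, Set.image_univ, span_range_coordForm, finrank_top,
    Subspace.dual_finrank_eq]

/-- A point where the coordinates in a flat vanish, and a given other coordinate does not. -/
lemma IsLinearRealization.exists_point_of_isFlat (hW : IsLinearRealization W M) {F : Set (Fin n)}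
    (hF : M.IsFlat F) {i : Fin n} (hi : i ∉ F) :
    ∃ w : W, (∀ j ∈ F, coordForm W j w = 0) ∧ coordForm W i w ≠ 0 := by
  obtain ⟨I, hI⟩ := M.exists_isBasis F (hW.subset_ground F)
  have hiI : i ∉ I := fun h => hi (hI.subset h)
  have hins : M.Indep (insert i I) := by
    have hcl : i ∉ M.closure I := by rwa [hI.closure_eq_closure, hF.closure]
    exact ((hI.indep.notMem_closure_iff_of_notMem hiI
      (hW.subset_ground Set.univ (Set.mem_univ i))).1 hcl)
  rw [hW.indep_iff, linearIndepOn_insert hiI, hW.span_isBasis hI] at hins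
  obtain ⟨φ, hφ, h0⟩ := Submodule.exists_le_ker_of_notMem hins.2
  obtain ⟨w, rfl⟩ := (evalEquiv k W).surjective φ
  exact ⟨w, fun j hj => h0 (Submodule.subset_span ⟨j, hj, rfl⟩), hφ⟩

/-- A point of `W^⊥` supported on a circuit, with a given nonzero coordinate. -/
lemma IsLinearRealization.exists_point_of_isCircuit (hW : IsLinearRealization W M)
    {C : Set (Fin n)} (hC : M.IsCircuit C) {i : Fin n} (hi : i ∈ C) :
    ∃ v : perp W, (∀ j ∉ C, coordForm (perp W) j v = 0) ∧ coordForm (perp W) i v ≠ 0 := by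
  classical
  have hmem : coordForm W i ∈ Submodule.span k (coordForm W '' (C \ {i})) := by
    by_contra hn
    apply hC.not_indep
    have h : insert i (C \ {i}) = C := Set.insert_sdiff_self_of_mem hi
    rw [← h, hW.indep_iff, linearIndepOn_insert (by simp), ← hW.indep_iff]
    exact ⟨hC.sdiff_singleton_indep hi, hn⟩
  obtain ⟨l, hl, hsum⟩ := (Finsupp.mem_span_image_iff_linearCombination k).1 hmem
  have hl' : ∀ j, j ∉ C \ {i} → l j = 0 := fun j hj => by
    by_contra h
    exact hj ((Finsupp.mem_supported k l).1 hl (Finsupp.mem_support_iff.2 h))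
  -- The coefficients of the dependency f_i - ∑ l_j f_j = 0 on C.
  refine ⟨⟨fun j => (Pi.single i 1 : Fin n → k) j - l j, ?_⟩, ?_, ?_⟩
  · intro w hw
    have h := congrArg (fun φ : Dual k W => φ ⟨w, hw⟩) hsum
    rw [Finsupp.linearCombination_apply, Finsupp.sum_fintype _ _ (by simp)] at h
    simp only [LinearMap.sum_apply, LinearMap.smul_apply, coordForm_apply, smul_eq_mul] at h
    simp [sub_mul, Finset.sum_sub_distrib, Pi.single_apply, h]
  · intro j hj
    have hji : j ≠ i := fun h => hj (h ▸ hi)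
    simp [hl' j (fun h => hj h.1), hji]
  · simp [hl' i (by simp)]

/-- The dimension of the space of relations between some coordinate functions. -/
lemma finrank_span_add_finrank_relations (W : Submodule k (Fin n → k)) (F : Set (Fin n)) :
    finrank k (Submodule.span k (coordForm W '' F)) +
      finrank k (Submodule.span k (coordForm (perp W) '' Fᶜ)).dualCoannihilator = F.ncard := by
  classical
  let ψ : (F → k) →ₗ[k] Dual k W := Fintype.linearCombination k fun i : F => coordForm W i
  let E : (F → k) →ₗ[k] (Fin n → k) := Function.ExtendByZero.linearMap k Subtype.val
  have hEmem : ∀ (c : F → k) (i : Fin n) (hi : i ∈ F), E c i = c ⟨i, hi⟩ := fun c i hi =>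
    Subtype.val_injective.extend_apply c (0 : Fin n → k) ⟨i, hi⟩
  have hEnot : ∀ (c : F → k) (i : Fin n), i ∉ F → E c i = 0 := fun c i hi => by
    refine Function.extend_apply' c (0 : Fin n → k) i ?_
    rintro ⟨j, rfl⟩
    exact hi j.2
  have hE : Function.Injective E := fun a b h => by
    ext ⟨i, hi⟩
    rw [← hEmem a i hi, h, hEmem]
  have hψ : ∀ (c : F → k) (w : W), ψ c w = ∑ i, E c i * (w : Fin n → k) i := by
    intro c w
    have h1 : ψ c w = ∑ i : F, c i * (w : Fin n → k) i := by
      simp [ψ, Fintype.linearCombination_apply]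
    rw [h1, ← Finset.sum_subset (Finset.subset_univ F.toFinset)
      (fun i _ hi => by rw [hEnot c i (by simpa using hi), zero_mul])]
    rw [Finset.sum_subtype (p := (· ∈ F)) F.toFinset (by simp)]
    exact Finset.sum_congr rfl fun i _ => by rw [hEmem c i i.2]
  -- Vectors of W^⊥ vanishing off F are exactly the zero extensions of linear relations among the
  -- f_i, i ∈ F; rank–nullity for ψ then gives the count.
  have hker : (Submodule.span k (coordForm (perp W) '' Fᶜ)).dualCoannihilator.map
      (perp W).subtype = (LinearMap.ker ψ).map E := by
    ext v
    simp only [Submodule.mem_map, Submodule.mem_dualCoannihilator, LinearMap.mem_ker]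
    constructor
    · rintro ⟨v, hv, rfl⟩
      have hEv : E (fun i => (v : Fin n → k) i) = v := by
        ext i
        by_cases hi : i ∈ F
        · rw [hEmem _ i hi]
        · rw [hEnot _ i hi]
          exact (hv _ (Submodule.subset_span ⟨i, hi, rfl⟩)).symm
      refine ⟨fun i => (v : Fin n → k) i, ?_, hEv⟩
      ext w
      rw [hψ, hEv]
      exact v.2 w w.2
    · rintro ⟨c, hc, rfl⟩
      have hmem : E c ∈ perp W := fun w hw => by
        rw [← hψ c ⟨w, hw⟩, hc]; rfl
      refine ⟨⟨E c, hmem⟩, ?_, rfl⟩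
      intro φ hφ
      have hle : Submodule.span k (coordForm (perp W) '' Fᶜ) ≤
          LinearMap.ker (Dual.eval k (perp W) ⟨E c, hmem⟩) := by
        rw [Submodule.span_le]
        rintro _ ⟨i, hi, rfl⟩
        exact hEnot c i hi
      exact hle hφ
  have h1 := LinearMap.finrank_range_add_finrank_ker ψ
  have h2 : LinearMap.range ψ = Submodule.span k (coordForm W '' F) := by
    rw [Fintype.range_linearCombination, Set.image_eq_range]
  have h3 := LinearEquiv.finrank_eq
    (Submodule.equivMapOfInjective _ (perp W).injective_subtype
      (Submodule.span k (coordForm (perp W) '' Fᶜ)).dualCoannihilator)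
  rw [hker, ← (Submodule.equivMapOfInjective E hE (LinearMap.ker ψ)).finrank_eq] at h3
  rw [h3, ← h2, h1, finrank_fintype_fun_eq_card, Fintype.card_eq_nat_card, Nat.card_coe_set_eq]

lemma finrank_add_finrank_perp (W : Submodule k (Fin n → k)) :
    finrank k W + finrank k (perp W) = n := by
  have h := finrank_span_add_finrank_relations W Set.univ
  have h0 : (Submodule.span k (coordForm (perp W) '' (Set.univ)ᶜ)).dualCoannihilator = ⊤ := by
    simp
  rw [h0, finrank_top, Set.image_univ, span_range_coordForm, finrank_top,
    Subspace.dual_finrank_eq] at h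
  simpa [Set.ncard_univ] using h

/-- Combines the count of relations with the dimension formula for annihilators in W^⊥. Written
additively to avoid natural-number subtraction. -/
lemma finrank_span_coordForm_perp (W : Submodule k (Fin n → k)) (F : Set (Fin n)) :
    finrank k (Submodule.span k (coordForm (perp W) '' Fᶜ)) + F.ncard + finrank k W =
      n + finrank k (Submodule.span k (coordForm W '' F)) := by
  have h1 := finrank_span_add_finrank_relations W F
  have h2 := Subspace.finrank_add_finrank_dualCoannihilator_eq
    (Submodule.span k (coordForm (perp W) '' Fᶜ))
  have h3 := finrank_add_finrank_perp W
  omega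

/-- The set of loops is a cyclic flat. -/
lemma isCyclicFlat_loops {α : Type*} (M : Matroid α) : IsCyclicFlat M M.loops := by
  refine ⟨M.isFlat_closure ∅, (fun e => {e}) '' M.loops, ?_, by simp⟩
  rintro _ ⟨e, he, rfl⟩
  exact Matroid.singleton_isCircuit.2 he

end Realization

/-! ### The bound attached to one cyclic flat -/

section LowerBound

variable {k : Type u} [Field k] {n : ℕ} {W : Submodule k (Fin n → k)} {M : Matroid (Fin n)}

lemma formLeft_mem_of_mem_span {s : Set (Dual k W)} {φ : Dual k W} {J : Ideal (PairRing W)}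
    (hφ : φ ∈ Submodule.span k s) (hJ : ∀ ψ ∈ s, formLeft W ψ ∈ J) : formLeft W φ ∈ J := by
  have hle : Submodule.span k s ≤ (J.restrictScalars k).comap (formLeft W) :=
    Submodule.span_le.2 hJ
  exact hle hφ

lemma formRight_mem_of_mem_span {s : Set (Dual k (perp W))} {φ : Dual k (perp W)}
    {J : Ideal (PairRing W)} (hφ : φ ∈ Submodule.span k s) (hJ : ∀ ψ ∈ s, formRight W ψ ∈ J) :
    formRight W φ ∈ J := by
  have hle : Submodule.span k s ≤ (J.restrictScalars k).comap (formRight W) :=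
    Submodule.span_le.2 hJ
  exact hle hφ

/-- The ideal of the linear subspace of `W × W^⊥` given by a cyclic flat contributes its
codimension as a lower bound for the projective dimension. -/
theorem finrank_add_finrank_le_projectiveDimension (hW : IsLinearRealization W M)
    {F : Set (Fin n)} (hF : IsCyclicFlat M F) :
    ((finrank k (Submodule.span k (coordForm W '' F)) +
      finrank k (Submodule.span k (coordForm (perp W) '' Fᶜ)) : ℕ) : WithBot ℕ∞) ≤
      projectiveDimension (ModuleCat.of (PairRing W) (PairRing W ⧸ idealOfPairs W)) := by
  classical
  generalize hU₁ : Submodule.span k (coordForm W '' F) = U₁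
  generalize hU₂ : Submodule.span k (coordForm (perp W) '' Fᶜ) = U₂
  obtain ⟨m₁, b₁, hb₁⟩ := exists_adapted_basis U₁
  obtain ⟨m₂, b₂, hb₂⟩ := exists_adapted_basis U₂
  let T : Finset ((Fin (finrank k U₁) ⊕ Fin m₁) ⊕ (Fin (finrank k U₂) ⊕ Fin m₂)) :=
    (Finset.univ.map Function.Embedding.inl).disjSum (Finset.univ.map Function.Embedding.inl)
  have hT : T.card = finrank k U₁ + finrank k U₂ := by simp [T]
  have hTmem : ∀ c ∈ T, (∃ i, c = Sum.inl (Sum.inl i)) ∨ ∃ i, c = Sum.inr (Sum.inl i) := by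
    intro c hc
    rcases c with (c | c) | (c | c) <;> simp [T] at hc ⊢
  let y := formVar b₁ b₂
  let J : Ideal (PairRing W) := Ideal.span (y '' T)
  have hfJ : ∀ i ∈ F, f W i ∈ J := by
    intro i hi
    have hmem : coordForm W i ∈ U₁ := hU₁ ▸ Submodule.subset_span ⟨i, hi, rfl⟩
    rw [← hb₁] at hmem
    refine formLeft_mem_of_mem_span hmem ?_
    rintro _ ⟨j, rfl⟩
    exact Ideal.subset_span ⟨Sum.inl (Sum.inl j), by simp [T], rfl⟩
  have hgJ : ∀ i ∉ F, g W i ∈ J := by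
    intro i hi
    have hmem : coordForm (perp W) i ∈ U₂ := hU₂ ▸ Submodule.subset_span ⟨i, hi, rfl⟩
    rw [← hb₂] at hmem
    refine formRight_mem_of_mem_span hmem ?_
    rintro _ ⟨j, rfl⟩
    exact Ideal.subset_span ⟨Sum.inr (Sum.inl j), by simp [T], rfl⟩
  let t : Fin n → PairRing W := fun i => if i ∈ F then g W i else f W i
  let s : PairRing W := ∏ i, t i
  have hs : ∀ i a, t i * a ∈ idealOfPairs W → s * a ∈ idealOfPairs W := by
    intro i a h
    obtain ⟨q, hq⟩ : t i ∣ s := Finset.dvd_prod_of_mem t (Finset.mem_univ i)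
    rw [hq, mul_right_comm]
    exact Ideal.mul_mem_right _ _ h
  have hpair : ∀ i, f W i * g W i ∈ idealOfPairs W := fun i => Ideal.subset_span ⟨i, rfl⟩
  -- Evaluation at points of the linear subspace cut out by J detects elements outside J.
  have hJmem : ∀ (w : W) (v : perp W), (∀ i ∈ F, coordForm W i w = 0) →
      (∀ i ∉ F, coordForm (perp W) i v = 0) → J ≤ RingHom.ker (evalPoint w v) := by
    intro w v hw hv
    rw [Ideal.span_le]
    rintro _ ⟨c, hc, rfl⟩
    change evalPoint w v (y c) = 0
    rcases hTmem c hc with ⟨i, rfl⟩ | ⟨i, rfl⟩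
    · have h1 : b₁ (Sum.inl i) ∈ U₁ := hb₁.le (Submodule.subset_span ⟨i, rfl⟩)
      have h2 : U₁ ≤ LinearMap.ker (Dual.eval k W w) := by
        rw [← hU₁, Submodule.span_le]
        rintro _ ⟨j, hj, rfl⟩
        exact hw j hj
      exact (evalPoint_formLeft w v _).trans (h2 h1)
    · have h1 : b₂ (Sum.inl i) ∈ U₂ := hb₂.le (Submodule.subset_span ⟨i, rfl⟩)
      have h2 : U₂ ≤ LinearMap.ker (Dual.eval k (perp W) v) := by
        rw [← hU₂, Submodule.span_le]
        rintro _ ⟨j, hj, rfl⟩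
        exact hv j hj
      exact (evalPoint_formRight w v _).trans (h2 h1)
  have ht : ∀ i, t i ∉ J := by
    intro i hi
    by_cases hiF : i ∈ F
    · simp only [t, hiF, if_true] at hi
      obtain ⟨-, 𝒞, h𝒞, rfl⟩ := hF
      obtain ⟨C, hC, hiC⟩ := hiF
      obtain ⟨v, hv, hvi⟩ := hW.exists_point_of_isCircuit (h𝒞 C hC) hiC
      have h := hJmem 0 v (fun j _ => map_zero _)
        (fun j hj => hv j fun hjC => hj ⟨C, hC, hjC⟩) hi
      rw [RingHom.mem_ker, ← formRight_coordForm, evalPoint_formRight] at h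
      exact hvi h
    · simp only [t, hiF, if_false] at hi
      obtain ⟨w, hw, hwi⟩ := hW.exists_point_of_isFlat hF.1 hiF
      have h := hJmem w 0 hw (fun j _ => map_zero _) hi
      rw [RingHom.mem_ker, ← formLeft_coordForm, evalPoint_formLeft] at h
      exact hwi h
  have hJprime : J.IsPrime := isPrime_span_formVar b₁ b₂ T
  rw [← hT]
  refine card_le_projectiveDimension (idealOfPairs W) s y T ?_ ?_ ?_ ?_
  · intro T' c hc r hr
    exact mem_span_formVar_of_mul_mem b₁ b₂ (by simpa using hc) hr
  · intro c hc
    -- This is the colon ideal (𝔞 : s). Its linear forms are closed under k-combinations, so the f_j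
    -- (j ∈ F) and g_j (j ∉ F) suffice in place of the adapted basis.
    let K : Ideal (PairRing W) := Submodule.comap (LinearMap.mulLeft (PairRing W) s) (idealOfPairs W)
    change y c ∈ K
    rcases hTmem c hc with ⟨i, rfl⟩ | ⟨i, rfl⟩
    · have h1 : b₁ (Sum.inl i) ∈ U₁ := hb₁.le (Submodule.subset_span ⟨i, rfl⟩)
      refine formLeft_mem_of_mem_span (hU₁.ge h1) ?_
      rintro _ ⟨j, hj, rfl⟩
      refine hs j _ ?_
      simp only [t, hj, if_true, formLeft_coordForm]
      rw [mul_comm]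
      exact hpair j
    · have h1 : b₂ (Sum.inl i) ∈ U₂ := hb₂.le (Submodule.subset_span ⟨i, rfl⟩)
      refine formRight_mem_of_mem_span (hU₂.ge h1) ?_
      rintro _ ⟨j, hj, rfl⟩
      refine hs j _ ?_
      have hj' : j ∉ F := hj
      simp only [t, hj', if_false, formRight_coordForm]
      exact hpair j
  · rw [idealOfPairs, Ideal.span_le]
    rintro _ ⟨i, rfl⟩
    by_cases hi : i ∈ F
    · exact J.mul_mem_right _ (hfJ i hi)
    · exact J.mul_mem_left _ (hgJ i hi)
  · intro m hm
    obtain ⟨i, -, hi⟩ := hJprime.prod_mem_iff.1 (hJprime.mem_of_pow_mem m hm)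
    exact ht i hi

end LowerBound

end IdealOfPairs

theorem corollary3p8 {k : Type*} [Field k] {n : ℕ} (W : Submodule k (Fin n → k))
    (M : Matroid (Fin n)) (hW : IdealOfPairs.IsLinearRealization W M) :
    ∃ d : ℕ,
      IsGreatest
        {z : ℤ | ∃ F : Set (Fin n), IdealOfPairs.IsCyclicFlat M F ∧
          z = 2 * ((M.eRk F).toNat : ℤ) - (F.ncard : ℤ) + (n : ℤ) - (M.eRank.toNat : ℤ)}
        (d : ℤ) ∧
      (d : WithBot ℕ∞) ≤
        CategoryTheory.projectiveDimension
          (ModuleCat.of (IdealOfPairs.PairRing W)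
            (IdealOfPairs.PairRing W ⧸ IdealOfPairs.idealOfPairs W)) := by
  obtain ⟨F, hF, hmax⟩ := Set.exists_max_image {F | IdealOfPairs.IsCyclicFlat M F}
    (fun F => 2 * ((M.eRk F).toNat : ℤ) - (F.ncard : ℤ) + (n : ℤ) - (M.eRank.toNat : ℤ))
    (Set.toFinite _) ⟨M.loops, IdealOfPairs.isCyclicFlat_loops M⟩
  -- The natural number d is the sum of the two span dimensions at a maximizing F, so the integer
  -- maximum is nonnegative automatically.
  refine ⟨_, ⟨⟨F, hF, ?_⟩, ?_⟩,
    IdealOfPairs.finrank_add_finrank_le_projectiveDimension hW hF⟩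
  · have h := IdealOfPairs.finrank_span_coordForm_perp W F
    rw [hW.eRk_toNat, hW.eRank_toNat]
    omega
  · rintro _ ⟨F', hF', rfl⟩
    refine (hmax F' hF').trans (le_of_eq ?_)
    have h := IdealOfPairs.finrank_span_coordForm_perp W F
    simp only [hW.eRk_toNat, hW.eRank_toNat]
    omega
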